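/- Let $(\Omega,\nu)=\prod_{t=1}^n(\Omega_t,\nu_t)$ be a product of finite probability spaces, and suppose that for every $t$ the number $p_t=\min_{\omega\in\Omega_t}\nu_t(\omega)$ satisfies $0<p_t\le \frac12$. Put $\sigma_t=\sqrt{p_t(1-p_t)}$ and $\sigma_S=\prod_{t\in S}\sigma_t$ for $S\subseteq[n]$. For $f:\Omega\to\mathbb{R}$ and $J\subseteq[n]$ let $\mathrm{E}_Jf(\omega)$ be the average of $f$ over the coordinates in $J$ (drawn from $\prod_{t\in J}\nu_t$), the coordinates of $\omega$ outside $J$ being kept fixed. Let $\mathrm{L}_tf=f-\mathrm{E}_{\{t\}}f$, and let $\mathrm{L}_S$ be the composition of the (commuting) operators $\mathrm{L}_t$, $t\in S$. Let $f^{=S}=\sum_{J\subseteq S}(-1)^{|S\setminus J|}\,\mathrm{E}_{[n]\setminus J}f$ be the Efron–Stein components of $f$, and let $\mathrm{T}_\rho f=\sum_{S\subseteq[n]}\rho^{|S|}f^{=S}$ be the noise operator. Norms are taken in $L^r(\Omega,\nu)$. Then for every $f:\Omega\to\mathbb{R}$, every even integer $q>2$ and every real $\rho$ with $0\le\rho\le\frac{1}{8q^{3/2}}$,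 $$\|\mathrm{T}_\rho f\|_q^q\;\le\;\sum_{S\subseteq[n]}\sigma_S^{2-q}\,\|\mathrm{L}_Sf\|_2^q .$$ -/

import Mathlib

open MeasureTheory

noncomputable section

namespace ProductSpace

/-- The least probability of an atom of a finite probability space. -/
def minAtom {α : Type*} [MeasurableSpace α] (ν : Measure α) : ℝ :=
  ⨅ a : α, ν.real {a}

/-- `σ = √(p (1 - p))`, where `p` is the least probability of an atom. -/
def sigma {α : Type*} [MeasurableSpace α] (ν : Measure α) : ℝ :=
  √(minAtom ν * (1 - minAtom ν))

variable {n : ℕ} {Ω : Fin n → Type*} [∀ t, MeasurableSpace (Ω t)]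

/-- `σ_S`, the product of the `σ_t` over `t ∈ S`. -/
def sigmaSet (ν : ∀ t, Measure (Ω t)) (S : Finset (Fin n)) : ℝ :=
  ∏ t ∈ S, sigma (ν t)

/-- The projection `E_J`: average over the coordinates in `J` (drawn independently from the
`ν t`), the other coordinates being kept fixed. -/
def proj (ν : ∀ t, Measure (Ω t)) (J : Finset (Fin n)) (f : (∀ t, Ω t) → ℝ) :
    (∀ t, Ω t) → ℝ :=
  fun ω => ∫ y, f (J.piecewise y ω) ∂(Measure.pi ν)

/-- The Laplacian `L_t f = f - E_t f`. -/
def laplacian (ν : ∀ t, Measure (Ω t)) (t : Fin n) (f : (∀ t, Ω t) → ℝ) :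
    (∀ t, Ω t) → ℝ :=
  fun ω => f ω - proj ν {t} f ω

/-- The generalised Laplacian `L_S`: the composition of the `L_t` over `t ∈ S`
(these operators commute; the composition is taken in increasing order of the indices). -/
def laplacianSet (ν : ∀ t, Measure (Ω t)) (S : Finset (Fin n)) (f : (∀ t, Ω t) → ℝ) :
    (∀ t, Ω t) → ℝ :=
  (S.sort (· ≤ ·)).foldr (fun t g => laplacian ν t g) f

/-- The Efron–Stein component `f^{=S} = ∑_{J ⊆ S} (-1)^{|S \ J|} f^{⊆ J}`, where
`f^{⊆ J} = E_{Jᶜ} f`. -/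
def efronStein (ν : ∀ t, Measure (Ω t)) (S : Finset (Fin n)) (f : (∀ t, Ω t) → ℝ) :
    (∀ t, Ω t) → ℝ :=
  fun ω => ∑ J ∈ S.powerset, (-1 : ℝ) ^ (S \ J).card * proj ν Jᶜ f ω

/-- The noise operator `T_ρ f = ∑_S ρ^{|S|} f^{=S}`. -/
def noise (ν : ∀ t, Measure (Ω t)) (ρ : ℝ) (f : (∀ t, Ω t) → ℝ) :
    (∀ t, Ω t) → ℝ :=
  fun ω => ∑ S : Finset (Fin n), ρ ^ S.card * efronStein ν S f ω

end ProductSpace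

end

/-!
In `‖T_ρ f‖_q^q` with `q = 2m`, pass from the `L^q` norm to the `L²` norm one coordinate at a time,
through the mixed norms that are `L²` in the coordinates already treated and `L^q` in the others.
Treating the coordinate `t` amounts to bounding the mean over `t` of `(α + 2ρs + ρ²δ)^m`, where `α`,
`s`, `δ` are the mixed second moments of `E_t g` and `L_t g`. Expand around `α`: as `α` does not
depend on `t` and `E_t s = 0`, the linear term in `s` averages to zero. By Cauchy–Schwarz
`s² ≤ αδ`, so the second-order remainder carries a factor `δ`, and the pointwise bound
`δ ≤ σ_t⁻² E_t δ` controls it by `E_t δ` at the price of the factor `σ_t^(2-q)`. The operators `L_t`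
commute with the noise operators of the other coordinates, so the induction over the coordinates
produces the sum over `S`.
-/

namespace ProductSpace

section RealInequalities

theorem abs_add_pow_sub_pow_sub_le {x u κ δ M : ℝ} (hx : |x| ≤ M) (hu : |u| ≤ κ * M)
    (hu_sq : u ^ 2 ≤ κ ^ 2 * (δ * M)) (m : ℕ) :
    |(x + u) ^ (m + 1) - x ^ (m + 1) - (m + 1) * x ^ m * u| ≤
      ((1 + κ) ^ (m + 1) - 1 - (m + 1) * κ) * (δ * M ^ m) := by
  induction m with
  | zero => simp
  | succ m ih =>
    have hM : 0 ≤ M := (abs_nonneg x).trans hx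
    have hxu : |x + u| ≤ (1 + κ) * M := (abs_add_le x u).trans (by linarith)
    have hlinear : |(m + 1) * x ^ m * u ^ 2| ≤ (m + 1) * M ^ m * (κ ^ 2 * (δ * M)) := by
      rw [abs_mul, abs_mul, abs_pow, abs_sq, abs_of_nonneg (by positivity : (0 : ℝ) ≤ m + 1)]
      gcongr
    calc |(x + u) ^ (m + 1 + 1) - x ^ (m + 1 + 1) - ((m + 1 : ℕ) + 1) * x ^ (m + 1) * u|
        = |(x + u) * ((x + u) ^ (m + 1) - x ^ (m + 1) - (m + 1) * x ^ m * u) +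
            (m + 1) * x ^ m * u ^ 2| := by
          congr 1
          push_cast
          ring
      _ ≤ |x + u| * |(x + u) ^ (m + 1) - x ^ (m + 1) - (m + 1) * x ^ m * u| +
            |(m + 1) * x ^ m * u ^ 2| := by
          rw [← abs_mul]
          exact abs_add_le _ _
      _ ≤ (1 + κ) * M * (((1 + κ) ^ (m + 1) - 1 - (m + 1) * κ) * (δ * M ^ m)) +
            (m + 1) * M ^ m * (κ ^ 2 * (δ * M)) := by
          gcongr
          exact (abs_nonneg _).trans hxu
      _ = ((1 + κ) ^ (m + 1 + 1) - 1 - ((m + 1 : ℕ) + 1) * κ) * (δ * M ^ (m + 1)) := by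
          push_cast
          ring

theorem one_add_pow_sub_one_sub_le_one {r : ℝ} {q : ℕ} (hr : 0 ≤ r) (hqr : q * r ≤ 1) :
    (1 + r) ^ q - 1 - q * r ≤ 1 := by
  have hqr₀ : 0 ≤ q * r := by positivity
  have hexp : (1 + r) ^ q ≤ Real.exp (q * r) := by
    rw [Real.exp_nat_mul]
    gcongr
    linarith [Real.add_one_le_exp r]
  have htaylor := abs_le.1 <|
    Real.abs_exp_sub_one_sub_id_le (x := q * r) (by rwa [abs_of_nonneg hqr₀])
  nlinarith

theorem abs_two_mul_mul_add_sq_mul_le {s δ w : ℝ} (hs : |s| ≤ w) (hδ : 0 ≤ δ) (hδw : δ ≤ w)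
    (ρ : ℝ) : |2 * ρ * s + ρ ^ 2 * δ| ≤ ((1 + |ρ|) ^ 2 - 1) * w := by
  calc |2 * ρ * s + ρ ^ 2 * δ| ≤ |2 * ρ * s| + |ρ ^ 2 * δ| := abs_add_le _ _
    _ = 2 * |ρ| * |s| + |ρ| ^ 2 * δ := by
      rw [abs_mul, abs_mul, abs_two, abs_mul, abs_of_nonneg hδ, abs_pow]
    _ ≤ 2 * |ρ| * w + |ρ| ^ 2 * w := by gcongr
    _ = ((1 + |ρ|) ^ 2 - 1) * w := by ring

theorem quadratic_pow_le {α δ s C ρ : ℝ} (hα : 0 ≤ α) (hδ : 0 ≤ δ) (hs : s ^ 2 ≤ α * δ)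
    (hδC : δ ≤ C) {m : ℕ} (hρ : 2 * (m + 1) * |ρ| ≤ 1) :
    (α + 2 * ρ * s + ρ ^ 2 * δ) ^ (m + 1) ≤
      α ^ (m + 1) + 2 * (m + 1) * ρ * α ^ m * s + δ * (α ^ m + C ^ m) := by
  set M := max α C
  have hαM : α ≤ M := le_max_left α C
  have hδM : δ ≤ M := hδC.trans (le_max_right α C)
  have hM : 0 ≤ M := hα.trans hαM
  -- `w` bounds both `|s|` and `δ`, and its square carries the factor `δ` of the remainder.
  set w := √(δ * M)
  have hw_sq : w ^ 2 = δ * M := Real.sq_sqrt (mul_nonneg hδ hM)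
  have hsw : |s| ≤ w := Real.abs_le_sqrt (hs.trans (by nlinarith))
  have hδw : δ ≤ w := Real.le_sqrt_of_sq_le (by nlinarith)
  have hwM : w ≤ M := Real.sqrt_le_iff.2 ⟨hM, by nlinarith⟩
  have hκ : 0 ≤ (1 + |ρ|) ^ 2 - 1 := by nlinarith [abs_nonneg ρ]
  have hu := abs_two_mul_mul_add_sq_mul_le hsw hδ hδw ρ
  have hu_sq := pow_le_pow_left₀ (abs_nonneg _) hu 2
  rw [sq_abs, mul_pow, hw_sq] at hu_sq
  have hremainder := (abs_le.1 <| abs_add_pow_sub_pow_sub_le (by rwa [abs_of_nonneg hα])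
    (hu.trans (mul_le_mul_of_nonneg_left hwM hκ)) hu_sq m).2
  have hfirst : (m + 1) * α ^ m * (ρ ^ 2 * δ) ≤ (m + 1) * M ^ m * (|ρ| ^ 2 * δ) := by
    rw [sq_abs]
    gcongr
  have hcoeff : ((1 + |ρ|) ^ (2 * (m + 1)) - 1 - 2 * (m + 1) * |ρ|) * (δ * M ^ m) ≤
      δ * M ^ m :=
    mul_le_of_le_one_left (by positivity) <| by
      exact_mod_cast one_add_pow_sub_one_sub_le_one (abs_nonneg ρ) (by exact_mod_cast hρ)
  have hmax : M ^ m ≤ α ^ m + C ^ m := by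
    rcases max_choice α C with h | h <;> simp only [M, h]
    · exact le_add_of_nonneg_right (pow_nonneg (hδ.trans hδC) m)
    · exact le_add_of_nonneg_left (pow_nonneg hα m)
  rw [add_sub_cancel, ← pow_mul] at hremainder
  linear_combination hremainder + hfirst + hcoeff + δ * hmax

end RealInequalities

section Integrals

theorem sq_integral_mul_le {X : Type*} [MeasurableSpace X] {μ : Measure X} {u v : X → ℝ}
    (hu : MemLp u 2 μ) (hv : MemLp v 2 μ) :
    (∫ x, u x * v x ∂μ) ^ 2 ≤ (∫ x, u x ^ 2 ∂μ) * ∫ x, v x ^ 2 ∂μ := by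
  have inner_toLp {f g : X → ℝ} (hf : MemLp f 2 μ) (hg : MemLp g 2 μ) :
      inner ℝ (hf.toLp f) (hg.toLp g) = ∫ x, f x * g x ∂μ := by
    rw [L2.inner_def]
    refine integral_congr_ae ?_
    filter_upwards [hf.coeFn_toLp, hg.coeFn_toLp] with x hfx hgx
    rw [hfx, hgx, RCLike.inner_apply, conj_trivial, mul_comm]
  simpa only [inner_toLp, ← sq] using real_inner_mul_inner_self_le (hu.toLp u) (hv.toLp v)

theorem lpNorm_two_mul_natCast_pow {X : Type*} [MeasurableSpace X] {μ : Measure X} {g : X → ℝ}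
    (hg : AEStronglyMeasurable g μ) {m : ℕ} (hm : m ≠ 0) :
    lpNorm g (2 * m : ℕ) μ ^ (2 * m) = ∫ x, (g x ^ 2) ^ m ∂μ := by
  have h2m : 2 * m ≠ 0 := by positivity
  rw [lpNorm_eq_integral_norm_rpow_toReal (by exact_mod_cast h2m) (ENNReal.natCast_ne_top _) hg,
    ENNReal.toReal_natCast, Real.rpow_inv_natCast_pow (integral_nonneg fun x => by positivity) h2m]
  simp only [Real.rpow_natCast, pow_mul, Real.norm_eq_abs, sq_abs]

variable {ι : Type*} [Fintype ι] [DecidableEq ι] {X : ι → Type*} [∀ i, MeasurableSpace (X i)]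
  (μ : ∀ i, Measure (X i)) [∀ i, IsProbabilityMeasure (μ i)]

theorem measurePreserving_piecewise (s : Finset ι) :
    MeasurePreserving (fun z : (∀ i, X i) × (∀ i, X i) => s.piecewise z.1 z.2)
      ((Measure.pi μ).prod (Measure.pi μ)) (Measure.pi μ) := by
  have hmeas : Measurable fun z : (∀ i, X i) × (∀ i, X i) => s.piecewise z.1 z.2 := by
    refine measurable_pi_lambda _ fun i => ?_
    by_cases hi : i ∈ s <;> simp only [Finset.piecewise, hi, if_true, if_false] <;> fun_prop
  refine ⟨hmeas, (Measure.pi_eq fun u hu => ?_).symm⟩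
  have hpreimage : (fun z : (∀ i, X i) × (∀ i, X i) => s.piecewise z.1 z.2) ⁻¹' Set.univ.pi u =
      (Set.univ.pi (s.piecewise u fun _ => Set.univ)) ×ˢ
        (Set.univ.pi (s.piecewise (fun _ => Set.univ) u)) := by
    ext z
    simp only [Set.mem_preimage, Set.mem_pi, Set.mem_univ, true_implies, Set.mem_prod,
      ← forall_and]
    refine forall_congr' fun i => ?_
    by_cases hi : i ∈ s <;> simp [hi]
  rw [Measure.map_apply hmeas (.univ_pi hu), hpreimage, Measure.prod_prod, Measure.pi_pi,
    Measure.pi_pi, ← Finset.prod_mul_distrib]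
  refine Finset.prod_congr rfl fun i _ => ?_
  by_cases hi : i ∈ s <;> simp [hi]

theorem integral_integral_piecewise {E : Type*} [NormedAddCommGroup E] [NormedSpace ℝ E]
    {f : (∀ i, X i) → E} (hf : Integrable f (Measure.pi μ)) (s : Finset ι) :
    ∫ ω, ∫ y, f (s.piecewise y ω) ∂(Measure.pi μ) ∂(Measure.pi μ) = ∫ ω, f ω ∂(Measure.pi μ) := by
  have hmp := measurePreserving_piecewise μ s
  calc ∫ ω, ∫ y, f (s.piecewise y ω) ∂(Measure.pi μ) ∂(Measure.pi μ)
      = ∫ z, f (s.piecewise z.1 z.2) ∂((Measure.pi μ).prod (Measure.pi μ)) :=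
        (integral_prod_symm _ (hmp.integrable_comp_of_integrable hf)).symm
    _ = ∫ ω, f ω ∂((Measure.pi μ).prod (Measure.pi μ)).map fun z => s.piecewise z.1 z.2 :=
        (integral_map hmp.aemeasurable (by simpa only [hmp.map_eq] using hf.1)).symm
    _ = ∫ ω, f ω ∂(Measure.pi μ) := by rw [hmp.map_eq]

end Integrals

section MinAtom

variable {α : Type*} [MeasurableSpace α] {ν : Measure α}

theorem minAtom_nonneg : 0 ≤ minAtom ν :=
  Real.iInf_nonneg fun _ => measureReal_nonneg

theorem sigma_pos (hp : 0 < minAtom ν ∧ minAtom ν ≤ 1 / 2) : 0 < sigma ν :=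
  Real.sqrt_pos.2 <| mul_pos hp.1 (by linarith)

theorem sigma_sq_le_minAtom : sigma ν ^ 2 ≤ minAtom ν := by
  rw [sigma, Real.sq_sqrt']
  exact max_le (by nlinarith [sq_nonneg (minAtom ν)]) minAtom_nonneg

theorem minAtom_mul_le_integral [MeasurableSingletonClass α] {f : α → ℝ} (hf : 0 ≤ f)
    (hfi : Integrable f ν) (a : α) : minAtom ν * f a ≤ ∫ x, f x ∂ν := by
  have hbdd : BddBelow (Set.range fun a => ν.real {a}) :=
    ⟨0, Set.forall_mem_range.2 fun _ => measureReal_nonneg⟩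
  calc minAtom ν * f a ≤ ν.real {a} * f a :=
        mul_le_mul_of_nonneg_right (ciInf_le hbdd a) (hf a)
    _ = ∫ x in {a}, f x ∂ν := by rw [integral_singleton, smul_eq_mul]
    _ ≤ ∫ x, f x ∂ν := setIntegral_le_integral hfi (.of_forall hf)

end MinAtom

section Projections

variable {n : ℕ} {Ω : Fin n → Type*} [∀ t, MeasurableSpace (Ω t)] (ν : ∀ t, Measure (Ω t))
  (J K : Finset (Fin n)) {u : (∀ t, Ω t) → ℝ}

theorem proj_smul (c : ℝ) (f : (∀ t, Ω t) → ℝ) : proj ν J (c • f) = c • proj ν J f :=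
  funext fun _ => integral_const_mul c _

theorem proj_nonneg {f : (∀ t, Ω t) → ℝ} (hf : 0 ≤ f) : 0 ≤ proj ν J f :=
  fun _ => integral_nonneg fun y => hf (J.piecewise y _)

theorem proj_univ (f : (∀ t, Ω t) → ℝ) (ω : ∀ t, Ω t) :
    proj ν Finset.univ f ω = ∫ y, f y ∂(Measure.pi ν) := by
  simp [proj]

variable {ν J} in
theorem proj_mul_of_proj_eq_self (hu : proj ν J u = u) (v : (∀ t, Ω t) → ℝ) :
    proj ν J (u * v) = u * proj ν J v := by
  have hconst (y ω : ∀ t, Ω t) : u (J.piecewise y ω) = u ω := by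
    rw [← hu]
    simp only [proj, Finset.piecewise_piecewise_of_subset_right subset_rfl]
  funext ω
  simp only [proj, Pi.mul_apply, hconst, integral_const_mul]

variable [∀ t, IsProbabilityMeasure (ν t)]

theorem proj_empty (f : (∀ t, Ω t) → ℝ) : proj ν ∅ f = f := by
  funext ω
  simp [proj]

variable {ν J} in
theorem proj_pow_of_proj_eq_self (hu : proj ν J u = u) (m : ℕ) : proj ν J (u ^ m) = u ^ m := by
  induction m with
  | zero => funext ω; simp [proj]
  | succ k ih => rw [pow_succ', proj_mul_of_proj_eq_self hu, ih]

variable [∀ t, Finite (Ω t)] [∀ t, MeasurableSingletonClass (Ω t)]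

theorem proj_add (f g : (∀ t, Ω t) → ℝ) : proj ν J (f + g) = proj ν J f + proj ν J g :=
  funext fun _ => integral_add .of_finite .of_finite

theorem proj_mono {f g : (∀ t, Ω t) → ℝ} (h : f ≤ g) : proj ν J f ≤ proj ν J g :=
  fun _ => integral_mono .of_finite .of_finite fun _ => h _

theorem integral_proj (f : (∀ t, Ω t) → ℝ) :
    ∫ ω, proj ν J f ω ∂(Measure.pi ν) = ∫ ω, f ω ∂(Measure.pi ν) :=
  integral_integral_piecewise ν .of_finite J

theorem proj_proj (f : (∀ t, Ω t) → ℝ) : proj ν J (proj ν K f) = proj ν (J ∪ K) f := by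
  funext ω
  have hglue (y z : ∀ t, Ω t) :
      K.piecewise z (J.piecewise y ω) = (J ∪ K).piecewise (K.piecewise z y) ω := by
    funext t
    by_cases hJ : t ∈ J <;> by_cases hK : t ∈ K <;> simp [hJ, hK]
  simp only [proj, hglue]
  exact integral_integral_piecewise ν (f := fun y => f ((J ∪ K).piecewise y ω)) .of_finite K

theorem proj_comm (f : (∀ t, Ω t) → ℝ) : proj ν J (proj ν K f) = proj ν K (proj ν J f) := by
  rw [proj_proj, proj_proj, Finset.union_comm]

theorem proj_insert (t : Fin n) (f : (∀ t, Ω t) → ℝ) :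
    proj ν (insert t J) f = proj ν {t} (proj ν J f) := by
  rw [proj_proj, Finset.insert_eq]

theorem proj_proj_self (f : (∀ t, Ω t) → ℝ) : proj ν J (proj ν J f) = proj ν J f := by
  rw [proj_proj, Finset.union_self]

theorem sq_proj_mul_le (u v : (∀ t, Ω t) → ℝ) :
    proj ν J (u * v) ^ 2 ≤ proj ν J (u ^ 2) * proj ν J (v ^ 2) :=
  fun _ => sq_integral_mul_le .of_discrete .of_discrete

theorem proj_singleton_apply (t : Fin n) (f : (∀ t, Ω t) → ℝ) (ω : ∀ t, Ω t) :
    proj ν {t} f ω = ∫ x, f (Function.update ω t x) ∂(ν t) := by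
  have heval := measurePreserving_eval ν t
  simp only [proj, Finset.piecewise_singleton]
  rw [← heval.map_eq]
  exact (integral_map (f := fun x => f (Function.update ω t x)) heval.aemeasurable
    (measurable_of_finite _).aestronglyMeasurable).symm

theorem sigma_sq_smul_le_proj (t : Fin n) {f : (∀ t, Ω t) → ℝ} (hf : 0 ≤ f) :
    sigma (ν t) ^ 2 • f ≤ proj ν {t} f := by
  intro ω
  calc sigma (ν t) ^ 2 * f ω ≤ minAtom (ν t) * f (Function.update ω t (ω t)) := by
        rw [Function.update_eq_self]
        exact mul_le_mul_of_nonneg_right sigma_sq_le_minAtom (hf ω)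
    _ ≤ ∫ x, f (Function.update ω t x) ∂(ν t) :=
        minAtom_mul_le_integral (f := fun x => f (Function.update ω t x)) (fun _ => hf _)
          .of_finite (ω t)
    _ = proj ν {t} f ω := (proj_singleton_apply ν t f ω).symm

end Projections

section OneCoordinate

variable {n : ℕ} {Ω : Fin n → Type*} [∀ t, MeasurableSpace (Ω t)] (ν : ∀ t, Measure (Ω t))
  [∀ t, IsProbabilityMeasure (ν t)] [∀ t, Finite (Ω t)] [∀ t, MeasurableSingletonClass (Ω t)]

theorem proj_singleton_pow_le {ρ : ℝ} {m : ℕ} (hρ : 2 * (m + 1) * |ρ| ≤ 1) {t : Fin n}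
    (hσ : 0 < sigma (ν t)) {α s δ : (∀ t, Ω t) → ℝ} (hα : 0 ≤ α) (hδ : 0 ≤ δ)
    (hs : s ^ 2 ≤ α * δ) (hα_fixed : proj ν {t} α = α) (hs_mean : proj ν {t} s = 0) :
    proj ν {t} ((α + (2 * ρ) • s + ρ ^ 2 • δ) ^ (m + 1)) ≤
      (α + proj ν {t} δ) ^ (m + 1) +
        (sigma (ν t) ^ (2 * m))⁻¹ • proj ν {t} δ ^ (m + 1) := by
  set D := proj ν {t} δ with hD
  set C := (sigma (ν t) ^ 2)⁻¹ • D with hC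
  have hD₀ : 0 ≤ D := proj_nonneg ν {t} hδ
  have hδC : δ ≤ C := fun ω =>
    (le_inv_mul_iff₀ (pow_pos hσ 2)).2 (sigma_sq_smul_le_proj ν t hδ ω)
  have hC_fixed : proj ν {t} C = C := by rw [hC, proj_smul, hD, proj_proj_self]
  have hαC_fixed : proj ν {t} (α ^ m + C ^ m) = α ^ m + C ^ m := by
    rw [proj_add, proj_pow_of_proj_eq_self hα_fixed, proj_pow_of_proj_eq_self hC_fixed]
  have hpointwise : (α + (2 * ρ) • s + ρ ^ 2 • δ) ^ (m + 1) ≤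
      α ^ (m + 1) + (2 * (m + 1) * ρ) • (α ^ m * s) + (α ^ m + C ^ m) * δ := fun ω =>
    (quadratic_pow_le (hα ω) (hδ ω) (hs ω) (hδC ω) hρ).trans_eq <| by
      simp only [Pi.add_apply, Pi.smul_apply, Pi.mul_apply, Pi.pow_apply, smul_eq_mul]
      ring
  refine (proj_mono ν {t} hpointwise).trans ?_
  rw [proj_add, proj_add, proj_smul, proj_mul_of_proj_eq_self hαC_fixed,
    proj_mul_of_proj_eq_self (proj_pow_of_proj_eq_self hα_fixed m), hs_mean,
    proj_pow_of_proj_eq_self hα_fixed, ← hD]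
  intro ω
  have hαD : α ω ^ m * (α ω + D ω) ≤ (α ω + D ω) ^ m * (α ω + D ω) :=
    mul_le_mul_of_nonneg_right
      (pow_le_pow_left₀ (hα ω) (le_add_of_nonneg_right (hD₀ ω)) m) (add_nonneg (hα ω) (hD₀ ω))
  simp only [hC, Pi.add_apply, Pi.smul_apply, Pi.mul_apply, Pi.pow_apply, Pi.zero_apply,
    smul_eq_mul, mul_pow, inv_pow, pow_mul, pow_succ _ m]
  linear_combination hαD

end OneCoordinate

section Operators

variable {n : ℕ} {Ω : Fin n → Type*} [∀ t, MeasurableSpace (Ω t)] (ν : ∀ t, Measure (Ω t))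
  [∀ t, IsProbabilityMeasure (ν t)] [∀ t, Finite (Ω t)] [∀ t, MeasurableSingletonClass (Ω t)]

/-- The projection `E_J` as a linear endomorphism of the space of functions on the product. -/
noncomputable def projEnd (J : Finset (Fin n)) : Module.End ℝ ((∀ t, Ω t) → ℝ) where
  toFun := proj ν J
  map_add' := proj_add ν J
  map_smul' := proj_smul ν J

/-- The Laplacian `L_t` as a linear endomorphism. -/
noncomputable def laplacianEnd (t : Fin n) : Module.End ℝ ((∀ t, Ω t) → ℝ) :=
  1 - projEnd ν {t}

/-- The generalised Laplacian `L_S` as a linear endomorphism, with the product of the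
`L_t = 1 - E_t` expanded so that no order of composition has to be chosen. -/
noncomputable def laplacianSetEnd (S : Finset (Fin n)) : Module.End ℝ ((∀ t, Ω t) → ℝ) :=
  ∑ J ∈ S.powerset, (-1 : ℝ) ^ J.card • projEnd ν J

/-- The noise operator acting on the coordinates in `B` only, which interpolates between the
identity and `T_ρ`. -/
noncomputable def partialNoise (ρ : ℝ) (B : Finset (Fin n)) : Module.End ℝ ((∀ t, Ω t) → ℝ) :=
  ∑ S ∈ B.powerset, ρ ^ S.card • (laplacianSetEnd ν S * projEnd ν (B \ S))

theorem projEnd_empty : projEnd ν ∅ = 1 :=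
  LinearMap.ext fun f => proj_empty ν f

theorem projEnd_mul_projEnd (J K : Finset (Fin n)) :
    projEnd ν J * projEnd ν K = projEnd ν (J ∪ K) :=
  LinearMap.ext fun f => proj_proj ν J K f

theorem projEnd_commute (J K : Finset (Fin n)) : Commute (projEnd ν J) (projEnd ν K) :=
  LinearMap.ext fun f => proj_comm ν J K f

theorem projEnd_commute_laplacianSetEnd (J S : Finset (Fin n)) :
    Commute (projEnd ν J) (laplacianSetEnd ν S) :=
  Commute.sum_right _ _ _ fun K _ => (projEnd_commute ν J K).smul_right _

theorem laplacianEnd_commute_laplacianSetEnd (t : Fin n) (S : Finset (Fin n)) :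
    Commute (laplacianEnd ν t) (laplacianSetEnd ν S) :=
  (Commute.one_left _).sub_left (projEnd_commute_laplacianSetEnd ν {t} S)

theorem laplacianEnd_commute_partialNoise (ρ : ℝ) (t : Fin n) (B : Finset (Fin n)) :
    Commute (laplacianEnd ν t) (partialNoise ν ρ B) :=
  Commute.sum_right _ _ _ fun S _ =>
    ((laplacianEnd_commute_laplacianSetEnd ν t S).mul_right
      ((Commute.one_left _).sub_left (projEnd_commute ν {t} _))).smul_right _

theorem laplacianSetEnd_empty : laplacianSetEnd ν ∅ = 1 := by
  simp [laplacianSetEnd, projEnd_empty]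

theorem laplacianSetEnd_insert {t : Fin n} {S : Finset (Fin n)} (ht : t ∉ S) :
    laplacianSetEnd ν (insert t S) = laplacianEnd ν t * laplacianSetEnd ν S := by
  have hinsert : ∑ J ∈ S.powerset, (-1 : ℝ) ^ (insert t J).card • projEnd ν (insert t J) =
      -(projEnd ν {t} * laplacianSetEnd ν S) := by
    rw [laplacianSetEnd, Finset.mul_sum, ← Finset.sum_neg_distrib]
    refine Finset.sum_congr rfl fun J hJ => ?_
    rw [Finset.card_insert_of_notMem fun h => ht (Finset.mem_powerset.1 hJ h), mul_smul_comm,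
      projEnd_mul_projEnd, ← Finset.insert_eq, pow_succ, mul_neg_one]
    exact neg_smul ((-1 : ℝ) ^ J.card) (projEnd ν (insert t J))
  rw [laplacianEnd, sub_mul, one_mul, sub_eq_add_neg, ← hinsert]
  exact Finset.sum_powerset_insert ht _

theorem laplacianSet_eq_laplacianSetEnd (S : Finset (Fin n)) (f : (∀ t, Ω t) → ℝ) :
    laplacianSet ν S f = laplacianSetEnd ν S f := by
  have hfoldr (l : List (Fin n)) (hl : l.Nodup) :
      l.foldr (fun t g => laplacian ν t g) f = laplacianSetEnd ν l.toFinset f := by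
    induction l with
    | nil => simp [laplacianSetEnd_empty]
    | cons t l ih =>
      rw [List.nodup_cons] at hl
      rw [List.foldr_cons, ih hl.2, List.toFinset_cons,
        laplacianSetEnd_insert ν (by simpa using hl.1)]
      rfl
  rw [laplacianSet, hfoldr _ (Finset.sort_nodup _ _), Finset.sort_toFinset]

theorem efronStein_eq_laplacianSetEnd_mul_projEnd (S : Finset (Fin n)) (f : (∀ t, Ω t) → ℝ) :
    efronStein ν S f = (laplacianSetEnd ν S * projEnd ν Sᶜ) f := by
  funext ω
  rw [efronStein, laplacianSetEnd, Finset.sum_mul, LinearMap.sum_apply, Finset.sum_apply]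
  refine Finset.sum_nbij' (S \ ·) (S \ ·) (by simp) (by simp)
    (fun J hJ => Finset.sdiff_sdiff_eq_self (Finset.mem_powerset.1 hJ))
    (fun J hJ => Finset.sdiff_sdiff_eq_self (Finset.mem_powerset.1 hJ)) fun J hJ => ?_
  have hcompl : Jᶜ = S \ J ∪ Sᶜ := by
    ext t
    have htS : t ∈ J → t ∈ S := fun h => Finset.mem_powerset.1 hJ h
    simp only [Finset.mem_compl, Finset.mem_union, Finset.mem_sdiff]
    tauto
  rw [smul_mul_assoc, projEnd_mul_projEnd, hcompl]
  rfl

theorem partialNoise_empty (ρ : ℝ) : partialNoise ν ρ ∅ = 1 := by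
  simp [partialNoise, laplacianSetEnd_empty, projEnd_empty]

theorem noise_eq_partialNoise_univ (ρ : ℝ) (f : (∀ t, Ω t) → ℝ) :
    noise ν ρ f = partialNoise ν ρ Finset.univ f := by
  funext ω
  simp [noise, partialNoise, efronStein_eq_laplacianSetEnd_mul_projEnd,
    Finset.compl_eq_univ_sdiff]

theorem partialNoise_insert (ρ : ℝ) {t : Fin n} {B : Finset (Fin n)} (ht : t ∉ B) :
    partialNoise ν ρ (insert t B) =
      (projEnd ν {t} + ρ • laplacianEnd ν t) * partialNoise ν ρ B := by
  rw [partialNoise, Finset.sum_powerset_insert ht, add_mul, partialNoise, Finset.mul_sum,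
    Finset.mul_sum]
  congr 1 <;> refine Finset.sum_congr rfl fun S hS => ?_ <;>
    have htS : t ∉ S := fun h => ht (Finset.mem_powerset.1 hS h)
  · rw [mul_smul_comm, ← mul_assoc, (projEnd_commute_laplacianSetEnd ν {t} S).eq, mul_assoc,
      projEnd_mul_projEnd, ← Finset.insert_eq, Finset.insert_sdiff_of_notMem _ htS]
  · rw [Finset.card_insert_of_notMem htS, laplacianSetEnd_insert ν htS,
      Finset.insert_sdiff_insert, Finset.sdiff_insert_of_notMem ht, mul_smul_comm, smul_mul_assoc,
      smul_smul, mul_assoc, pow_succ]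

end Operators

section MixedNorm

variable {n : ℕ} {Ω : Fin n → Type*} [∀ t, MeasurableSpace (Ω t)] (ν : ∀ t, Measure (Ω t))

/-- The `2m`-th power of the mixed norm which is `L²` in the coordinates in `A` and `L²ᵐ` in the
others. -/
noncomputable def mixedNormPow (m : ℕ) (A : Finset (Fin n)) (g : (∀ t, Ω t) → ℝ) : ℝ :=
  ∫ ω, proj ν A (g ^ 2) ω ^ m ∂(Measure.pi ν)

variable [∀ t, IsProbabilityMeasure (ν t)] [∀ t, Finite (Ω t)]
  [∀ t, MeasurableSingletonClass (Ω t)]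

theorem mixedNormPow_empty {m : ℕ} (hm : m ≠ 0) (g : (∀ t, Ω t) → ℝ) :
    mixedNormPow ν m ∅ g = lpNorm g (2 * m : ℕ) (Measure.pi ν) ^ (2 * m) := by
  rw [lpNorm_two_mul_natCast_pow (measurable_of_finite g).aestronglyMeasurable hm, mixedNormPow,
    proj_empty]
  rfl

theorem mixedNormPow_univ (m : ℕ) (g : (∀ t, Ω t) → ℝ) :
    mixedNormPow ν m Finset.univ g = lpNorm g 2 (Measure.pi ν) ^ (2 * m) := by
  have htwo := lpNorm_two_mul_natCast_pow (μ := Measure.pi ν)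
    (measurable_of_finite g).aestronglyMeasurable one_ne_zero
  simp only [mul_one, Nat.cast_ofNat, pow_one] at htwo
  simp [mixedNormPow, proj_univ, pow_mul, htwo]

theorem proj_singleton_laplacian (t : Fin n) (g : (∀ t, Ω t) → ℝ) :
    proj ν {t} (laplacian ν t g) = 0 := by
  change projEnd ν {t} (g - proj ν {t} g) = 0
  rw [map_sub]
  exact sub_eq_zero.2 (proj_proj_self ν {t} g).symm

theorem proj_singleton_proj_sq_proj (A : Finset (Fin n)) (t : Fin n) (g : (∀ t, Ω t) → ℝ) :
    proj ν {t} (proj ν A (proj ν {t} g ^ 2)) = proj ν A (proj ν {t} g ^ 2) := by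
  rw [proj_comm, proj_pow_of_proj_eq_self (proj_proj_self ν {t} g)]

theorem proj_singleton_proj_proj_mul_laplacian (A : Finset (Fin n)) (t : Fin n)
    (g : (∀ t, Ω t) → ℝ) : proj ν {t} (proj ν A (proj ν {t} g * laplacian ν t g)) = 0 := by
  rw [proj_comm, proj_mul_of_proj_eq_self (proj_proj_self ν {t} g), proj_singleton_laplacian,
    mul_zero]
  exact map_zero (projEnd ν A)

theorem proj_add_smul_sq (A : Finset (Fin n)) (u v : (∀ t, Ω t) → ℝ) (c : ℝ) :
    proj ν A ((u + c • v) ^ 2) =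
      proj ν A (u ^ 2) + (2 * c) • proj ν A (u * v) + c ^ 2 • proj ν A (v ^ 2) := by
  have hexpand : (u + c • v) ^ 2 = u ^ 2 + (2 * c) • (u * v) + c ^ 2 • v ^ 2 := by
    funext ω
    simp only [Pi.add_apply, Pi.pow_apply, Pi.smul_apply, Pi.mul_apply, smul_eq_mul]
    ring
  rw [hexpand, proj_add, proj_add, proj_smul, proj_smul]

theorem proj_insert_sq_eq_add (A : Finset (Fin n)) (t : Fin n) (g : (∀ t, Ω t) → ℝ) :
    proj ν (insert t A) (g ^ 2) =
      proj ν A (proj ν {t} g ^ 2) + proj ν (insert t A) (laplacian ν t g ^ 2) := by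
  have hdecomp : g = proj ν {t} g + (1 : ℝ) • laplacian ν t g := by
    funext ω
    simp [laplacian]
  conv_lhs => rw [hdecomp, proj_insert, proj_add_smul_sq]
  rw [proj_add, proj_add, proj_smul, proj_smul, proj_singleton_proj_sq_proj,
    proj_singleton_proj_proj_mul_laplacian, smul_zero, add_zero, one_pow, one_smul, proj_insert]

theorem mixedNormPow_proj_add_smul_laplacian_le {ρ : ℝ} {m : ℕ} (hρ : 2 * (m + 1) * |ρ| ≤ 1)
    (A : Finset (Fin n)) {t : Fin n} (hσ : 0 < sigma (ν t)) (g : (∀ t, Ω t) → ℝ) :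
    mixedNormPow ν (m + 1) A (proj ν {t} g + ρ • laplacian ν t g) ≤
      mixedNormPow ν (m + 1) (insert t A) g +
        (sigma (ν t) ^ (2 * m))⁻¹ * mixedNormPow ν (m + 1) (insert t A) (laplacian ν t g) := by
  have haverage := proj_singleton_pow_le ν hρ hσ (α := proj ν A (proj ν {t} g ^ 2))
    (δ := proj ν A (laplacian ν t g ^ 2))
    (proj_nonneg ν A fun ω => sq_nonneg (proj ν {t} g ω))
    (proj_nonneg ν A fun ω => sq_nonneg (laplacian ν t g ω))
    (sq_proj_mul_le ν A (proj ν {t} g) (laplacian ν t g))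
    (proj_singleton_proj_sq_proj ν A t g) (proj_singleton_proj_proj_mul_laplacian ν A t g)
  rw [← proj_add_smul_sq, ← proj_insert, ← proj_insert_sq_eq_add] at haverage
  have hintegral := integral_mono (μ := Measure.pi ν) .of_finite .of_finite haverage
  rw [integral_proj] at hintegral
  refine hintegral.trans_eq ?_
  rw [mixedNormPow, mixedNormPow, ← integral_const_mul, ← integral_add .of_finite .of_finite]
  rfl

theorem mixedNormPow_partialNoise_le (hσ : ∀ t, 0 < sigma (ν t)) {ρ : ℝ} {m : ℕ}
    (hρ : 2 * (m + 1) * |ρ| ≤ 1) (A B : Finset (Fin n)) (f : (∀ t, Ω t) → ℝ) :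
    mixedNormPow ν (m + 1) A (partialNoise ν ρ B f) ≤
      ∑ S ∈ B.powerset, (sigmaSet ν S ^ (2 * m))⁻¹ *
        mixedNormPow ν (m + 1) (A ∪ B) (laplacianSetEnd ν S f) := by
  induction B using Finset.induction_on generalizing A f with
  | empty => simp [sigmaSet, partialNoise_empty, laplacianSetEnd_empty]
  | insert t B ht ih =>
    have hcomm : laplacian ν t (partialNoise ν ρ B f) = partialNoise ν ρ B (laplacianEnd ν t f) :=
      LinearMap.congr_fun (laplacianEnd_commute_partialNoise ν ρ t B).eq f
    have hterm : ∀ S ∈ B.powerset,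
        (sigma (ν t) ^ (2 * m))⁻¹ * ((sigmaSet ν S ^ (2 * m))⁻¹ *
          mixedNormPow ν (m + 1) (insert t A ∪ B) (laplacianSetEnd ν S (laplacianEnd ν t f))) =
        (sigmaSet ν (insert t S) ^ (2 * m))⁻¹ *
          mixedNormPow ν (m + 1) (insert t A ∪ B) (laplacianSetEnd ν (insert t S) f) := by
      intro S hS
      have htS : t ∉ S := fun h => ht (Finset.mem_powerset.1 hS h)
      rw [laplacianSetEnd_insert ν htS, (laplacianEnd_commute_laplacianSetEnd ν t S).eq, sigmaSet,
        sigmaSet, Finset.prod_insert htS, mul_pow, mul_inv, mul_assoc]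
      rfl
    calc mixedNormPow ν (m + 1) A (partialNoise ν ρ (insert t B) f)
        = mixedNormPow ν (m + 1) A (proj ν {t} (partialNoise ν ρ B f) +
            ρ • laplacian ν t (partialNoise ν ρ B f)) := by
          rw [partialNoise_insert ν ρ ht]
          rfl
      _ ≤ mixedNormPow ν (m + 1) (insert t A) (partialNoise ν ρ B f) +
            (sigma (ν t) ^ (2 * m))⁻¹ *
              mixedNormPow ν (m + 1) (insert t A) (partialNoise ν ρ B (laplacianEnd ν t f)) := by
          rw [← hcomm]
          exact mixedNormPow_proj_add_smul_laplacian_le ν hρ A (hσ t) _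
      _ ≤ _ := add_le_add (ih _ _) <| mul_le_mul_of_nonneg_left (ih _ _) <|
          inv_nonneg.2 (pow_nonneg (hσ t).le _)
      _ = _ := by
          rw [Finset.sum_powerset_insert ht, Finset.union_insert, ← Finset.insert_union,
            Finset.mul_sum, Finset.sum_congr rfl hterm]

end MixedNorm

theorem natCast_mul_le_one_of_le {q : ℕ} (hq : q ≠ 0) {ρ : ℝ} (hρ : 0 ≤ ρ)
    (hρq : ρ ≤ 1 / (8 * (q : ℝ) ^ (3 / 2 : ℝ))) : q * ρ ≤ 1 := by
  have hq₁ : (1 : ℝ) ≤ q := by exact_mod_cast Nat.one_le_iff_ne_zero.2 hq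
  have hqpow : (q : ℝ) ≤ (q : ℝ) ^ (3 / 2 : ℝ) :=
    Real.self_le_rpow_of_one_le hq₁ (by norm_num)
  have hρ_mul := (le_div_iff₀ (by positivity)).1 hρq
  nlinarith [mul_le_mul_of_nonneg_right hqpow hρ]

end ProductSpace

theorem mainTheorem10_general {n : ℕ} {Ω : Fin n → Type*} [∀ t, Finite (Ω t)]
    [∀ t, MeasurableSpace (Ω t)] [∀ t, MeasurableSingletonClass (Ω t)]
    (ν : ∀ t, Measure (Ω t)) [∀ t, IsProbabilityMeasure (ν t)]
    (hσ : ∀ t, 0 < ProductSpace.sigma (ν t)) (f : (∀ t, Ω t) → ℝ) {q : ℕ} (hq : q ≠ 0)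
    (hq_even : Even q) {ρ : ℝ} (hρ : q * |ρ| ≤ 1) :
    lpNorm (ProductSpace.noise ν ρ f) q (Measure.pi ν) ^ q ≤
      ∑ S : Finset (Fin n), ProductSpace.sigmaSet ν S ^ (2 - (q : ℤ)) *
        lpNorm (ProductSpace.laplacianSet ν S f) 2 (Measure.pi ν) ^ q := by
  obtain ⟨m, rfl⟩ : ∃ m, q = 2 * (m + 1) := by
    obtain ⟨k, rfl⟩ := hq_even
    exact ⟨k - 1, by omega⟩
  have hmixed := ProductSpace.mixedNormPow_partialNoise_le ν hσ (m := m)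
    (by exact_mod_cast hρ) ∅ Finset.univ f
  rw [← ProductSpace.noise_eq_partialNoise_univ, ProductSpace.mixedNormPow_empty ν m.succ_ne_zero,
    Finset.powerset_univ, Finset.empty_union] at hmixed
  refine hmixed.trans_eq (Finset.sum_congr rfl fun S _ => ?_)
  have hexponent : (2 : ℤ) - (2 * (m + 1) : ℕ) = -(2 * m : ℕ) := by push_cast; ring
  rw [ProductSpace.mixedNormPow_univ, ProductSpace.laplacianSet_eq_laplacianSetEnd, hexponent,
    zpow_neg, zpow_natCast]

theorem mainTheorem10 {n : ℕ} {Ω : Fin n → Type*} [∀ t, Fintype (Ω t)]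
    [∀ t, MeasurableSpace (Ω t)] [∀ t, MeasurableSingletonClass (Ω t)]
    (ν : ∀ t, Measure (Ω t)) [∀ t, IsProbabilityMeasure (ν t)]
    (hp : ∀ t, 0 < ProductSpace.minAtom (ν t) ∧ ProductSpace.minAtom (ν t) ≤ 1 / 2)
    (f : (∀ t, Ω t) → ℝ) (q : ℕ) (hq : 2 < q) (hq_even : Even q)
    (ρ : ℝ) (hρ_nonneg : 0 ≤ ρ) (hρ : ρ ≤ 1 / (8 * (q : ℝ) ^ (3 / 2 : ℝ))) :
    lpNorm (ProductSpace.noise ν ρ f) q (Measure.pi ν) ^ q ≤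
      ∑ S : Finset (Fin n), ProductSpace.sigmaSet ν S ^ (2 - (q : ℤ)) *
        lpNorm (ProductSpace.laplacianSet ν S f) 2 (Measure.pi ν) ^ q :=
  mainTheorem10_general ν (fun t => ProductSpace.sigma_pos (hp t)) f (by omega) hq_even <| by
    simpa only [abs_of_nonneg hρ_nonneg] using
      ProductSpace.natCast_mul_le_one_of_le (by omega) hρ_nonneg hρ
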